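/- Let $\Theta$ be a smooth finite-dimensional Riemannian manifold (compact or not, with or without boundary), $N\ge 1$, $x_1,\dots,x_N\in\mathbb R^{d}$, labels $y_1,\dots,y_N\in\mathcal Y$, $\varepsilon>0$, $\beta>0$, $\gamma,\alpha\ge 0$, and let $B_\varepsilon(x_i)=\{x:\|x-x_i\|_\infty\le\varepsilon\}$ with uniform distribution $u_i$. Let $\ell:\Theta\times(\mathbb R^{d}\times\mathcal Y)\to[0,U]$ be such that $\ell(\cdot,(\cdot,y))$ is jointly measurable for each $y$. Let $\Sigma$ be the set of families $\nu=(\nu_1,\dots,\nu_N)$ with $\nu_i$ a probability measure on $B_\varepsilon(x_i)$, and for a probability measure $\mu$ on $\Theta$ and $\nu\in\Sigma$ put $$\mathcal L(\mu,\nu)=\frac1N\sum_{i=1}^N\mathbb E_{\theta\sim\mu,\,x\sim\nu_i}[\ell(\theta,(x,y_i))],\qquad \mathcal H(\nu)=\frac1N\sum_{i=1}^N\mathrm{KL}(\nu_i\|u_i)\in[0,\infty].$$ For a curve of measures $m$ write $\bar m(T)=\frac1T\int_0^T m(s)\,ds$. Let $\mu^0$ be a probability measure on $\Theta$ and $\nu^0\in\Sigma$.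 Let $(\mu(t),\nu(t))_{t\ge0}$ be a solution of the WFR-LBR dynamics started at $(\mu^0,\nu^0)$, that is: * $t\mapsto\mu(t)$ is a measurable curve of probability measures on $\Theta$ with $\mu(0)=\mu^0$ that solves the Wasserstein-Fisher-Rao equation $$\partial_t\mu=\gamma\,\mathrm{div}(\mu\nabla V_t)-\alpha\,\mu\Big(V_t-\int V_t\,d\mu\Big),\qquad V_t(\theta)=\frac1N\sum_{i=1}^N\mathbb E_{x\sim\nu_i(t)}[\ell(\theta,(x,y_i))],$$ weakly against test functions in $C_c^\infty(\Theta)$, where each $V_t$ is differentiable and the integrals in the weak form converge; * $\nu(t)=\nu^0$ for $0\le t<1$, and for $t\ge1$, $\nu(t)$ is the logit best response to the time-averaged classifier: $\nu(t)\in\arg\max_{\nu\in\Sigma}\{\mathcal L(\bar\mu(t),\nu)-\beta\mathcal H(\nu)\}$. Then $t\mapsto\mathcal L(\mu(t),\nu(t))$ is integrable on bounded intervals of $[0,\infty)$, $\mathcal H(\nu(t))<\infty$ for all $t\ge1$, and if $\mathcal H(\nu^0)<\infty$ then $\mathcal H(\bar\nu(t))<\infty$ for all $t\ge1$. Moreover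 the dual potential $$\mathcal R_\nu(T)=\mathcal L(\bar\mu(T),\nu(T))-\beta\mathcal H(\nu(T))-\frac1T\int_0^T\mathcal L(\mu(t),\nu(t))\,dt+\beta\mathcal H(\bar\nu(T))\in(-\infty,\infty]$$ satisfies $$\mathcal R_\nu(t)\le\frac{\mathcal R_\nu(1)}{t}\qquad\text{for all }t\ge1.$$ -/

import Mathlib

open Set MeasureTheory
open scoped ENNReal Manifold ContDiff Bundle

noncomputable section

namespace RandomizedAT

/-- The closed `ℓ_∞` ball of radius `ε` around `c` (`Fin d → ℝ` carries the sup norm). -/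
def attackBall {d : ℕ} (c : Fin d → ℝ) (ε : ℝ) : Set (Fin d → ℝ) :=
  Metric.closedBall c ε

/-- Attacker strategies: families `(ν_1, …, ν_N)` where `ν_i` is a probability measure
concentrated on the `ε`-ball around the `i`-th data point. -/
def attackerStrategies {N d : ℕ} (x : Fin N → Fin d → ℝ) (ε : ℝ) :
    Set (Fin N → Measure (Fin d → ℝ)) :=
  {ν | ∀ i, IsProbabilityMeasure (ν i) ∧ ν i (attackBall (x i) ε)ᶜ = 0}

/-- The uniform distribution on the `ε`-ball around `c`. -/
def uniformBall {d : ℕ} (c : Fin d → ℝ) (ε : ℝ) : Measure (Fin d → ℝ) :=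
  ProbabilityTheory.cond volume (attackBall c ε)

/-- First variation in the classifier: `θ ↦ (1/N) ∑ i, 𝔼_{x ∼ ν_i} ℓ(θ, (x, y_i))`. -/
def potential {Θ 𝒴 : Type*} {N d : ℕ} (ℓ : Θ → (Fin d → ℝ) × 𝒴 → ℝ) (y : Fin N → 𝒴)
    (ν : Fin N → Measure (Fin d → ℝ)) (θ : Θ) : ℝ :=
  (N : ℝ)⁻¹ * ∑ i, ∫ x', ℓ θ (x', y i) ∂(ν i)

/-- The payoff `ℒ(μ, ν) = (1/N) ∑ i, 𝔼_{θ ∼ μ, x ∼ ν_i} ℓ(θ, (x, y_i))`. -/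
def payoff {Θ 𝒴 : Type*} [MeasurableSpace Θ] {N d : ℕ} (ℓ : Θ → (Fin d → ℝ) × 𝒴 → ℝ)
    (y : Fin N → 𝒴) (μ : Measure Θ) (ν : Fin N → Measure (Fin d → ℝ)) : ℝ :=
  (N : ℝ)⁻¹ * ∑ i, ∫ θ, ∫ x', ℓ θ (x', y i) ∂(ν i) ∂μ

/-- The regularizer `ℋ(ν) = (1/N) ∑ i, KL(ν_i ‖ u_i)`, with `u_i` uniform on the `i`-th ball;
it may be infinite. -/
def regularizer {N d : ℕ} (x : Fin N → Fin d → ℝ) (ε : ℝ)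
    (ν : Fin N → Measure (Fin d → ℝ)) : ℝ≥0∞ :=
  (N : ℝ≥0∞)⁻¹ * ∑ i, InformationTheory.klDiv (ν i) (uniformBall (x i) ε)

/-- The regularized payoff `ℒ(μ, ν) - β ℋ(ν)`, equal to `-∞` when `ℋ(ν) = ∞`. -/
def regPayoff {Θ 𝒴 : Type*} [MeasurableSpace Θ] {N d : ℕ} (ℓ : Θ → (Fin d → ℝ) × 𝒴 → ℝ)
    (x : Fin N → Fin d → ℝ) (y : Fin N → 𝒴) (ε β : ℝ) (μ : Measure Θ)
    (ν : Fin N → Measure (Fin d → ℝ)) : EReal :=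
  ((payoff ℓ y μ ν : ℝ) : EReal) - (β : EReal) * ((regularizer x ε ν : ℝ≥0∞) : EReal)

/-- `ν` is the logit (entropically regularized) best response of the attacker to `μ`: it
maximizes `ν' ↦ ℒ(μ, ν') - β ℋ(ν')` over all attacker strategies. -/
def IsLogitBestResponse {Θ 𝒴 : Type*} [MeasurableSpace Θ] {N d : ℕ}
    (ℓ : Θ → (Fin d → ℝ) × 𝒴 → ℝ) (x : Fin N → Fin d → ℝ) (y : Fin N → 𝒴) (ε β : ℝ)
    (μ : Measure Θ) (ν : Fin N → Measure (Fin d → ℝ)) : Prop :=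
  ν ∈ attackerStrategies x ε ∧
    IsMaxOn (fun ν' => regPayoff ℓ x y ε β μ ν') (attackerStrategies x ε) ν

/-- The time average `(1/T) ∫_0^T m(s) ds` of a curve of measures. -/
def timeAverage {Ω : Type*} [MeasurableSpace Ω] (m : ℝ → Measure Ω) (T : ℝ) : Measure Ω :=
  (ENNReal.ofReal T)⁻¹ • Measure.bind (volume.restrict (Ioc 0 T)) m

section Flow

variable {E : Type*} [NormedAddCommGroup E] [NormedSpace ℝ E] [FiniteDimensional ℝ E]
  {H : Type*} [TopologicalSpace H] (I : ModelWithCorners ℝ E H)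
  {Θ : Type*} [TopologicalSpace Θ] [ChartedSpace H Θ] [IsManifold I ∞ Θ]
  [Bundle.RiemannianBundle (fun θ : Θ => TangentSpace I θ)]

/-- The Riemannian gradient of a real function. -/
def riemannianGradient (f : Θ → ℝ) (θ : Θ) : TangentSpace I θ :=
  haveI : FiniteDimensional ℝ (TangentSpace I θ) := inferInstanceAs (FiniteDimensional ℝ E)
  haveI : CompleteSpace (TangentSpace I θ) := FiniteDimensional.complete ℝ (TangentSpace I θ)
  (InnerProductSpace.toDual ℝ (TangentSpace I θ)).symm (mfderiv I 𝓘(ℝ, ℝ) f θ)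

/-- The right-hand side of the Wasserstein-Fisher-Rao equation
`∂_t μ = γ div (μ ∇V) - α μ (V - ∫ V dμ)`, tested against `φ`:
`-γ ∫ ⟪∇φ, ∇V⟫ dμ - α ∫ φ (V - ∫ V dμ) dμ`. -/
def wfrRate [MeasurableSpace Θ] (γ α : ℝ) (V : Θ → ℝ) (μ : Measure Θ) (φ : Θ → ℝ) : ℝ :=
  -γ * ∫ θ, inner ℝ (riemannianGradient I φ θ) (riemannianGradient I V θ) ∂μ
    - α * ∫ θ, φ θ * (V θ - ∫ θ', V θ' ∂μ) ∂μ

/-- `(μ, ν)` is a solution of the WFR-LBR dynamics on `[0, ∞)` with initial values `(μ0, ν0)`: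
the classifier `μ` is a weak solution of the Wasserstein-Fisher-Rao gradient flow of
`ℒ(·, ν(t))`, and the attacker plays `ν0` for `t < 1` and the logit best response to the
time-averaged classifier for `t ≥ 1`. Values at negative times play no role. -/
structure IsWFRLBRFlow [MeasurableSpace Θ] {𝒴 : Type*} {N d : ℕ}
    (ℓ : Θ → (Fin d → ℝ) × 𝒴 → ℝ) (x : Fin N → Fin d → ℝ) (y : Fin N → 𝒴)
    (ε β γ α : ℝ) (μ0 : Measure Θ) (ν0 : Fin N → Measure (Fin d → ℝ))
    (μ : ℝ → Measure Θ) (ν : ℝ → Fin N → Measure (Fin d → ℝ)) : Prop where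
  prob : ∀ t, 0 ≤ t → IsProbabilityMeasure (μ t)
  meas : AEMeasurable μ (volume.restrict (Ici 0))
  init : μ 0 = μ0
  /-- The potentials driving the flow have gradients. -/
  diff : ∀ t, 0 ≤ t → MDifferentiable I 𝓘(ℝ, ℝ) (potential ℓ y (ν t))
  inner_integrable : ∀ φ : Θ → ℝ, ContMDiff I 𝓘(ℝ, ℝ) ∞ φ → HasCompactSupport φ →
    ∀ t, 0 ≤ t → Integrable (fun θ => inner ℝ (riemannianGradient I φ θ)
      (riemannianGradient I (potential ℓ y (ν t)) θ)) (μ t)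
  rate_integrable : ∀ φ : Θ → ℝ, ContMDiff I 𝓘(ℝ, ℝ) ∞ φ → HasCompactSupport φ →
    ∀ t, 0 ≤ t → IntervalIntegrable
      (fun s => wfrRate I γ α (potential ℓ y (ν s)) (μ s) φ) volume 0 t
  weak : ∀ φ : Θ → ℝ, ContMDiff I 𝓘(ℝ, ℝ) ∞ φ → HasCompactSupport φ →
    ∀ t, 0 ≤ t → ∫ θ, φ θ ∂(μ t) = ∫ θ, φ θ ∂(μ 0) +
      ∫ s in (0 : ℝ)..t, wfrRate I γ α (potential ℓ y (ν s)) (μ s) φ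
  nu_init : ∀ t, 0 ≤ t → t < 1 → ν t = ν0
  nu_lbr : ∀ t, 1 ≤ t → IsLogitBestResponse ℓ x y ε β (timeAverage μ t) (ν t)

end Flow

/-- The dual potential
`ℛ_ν(T) = ℒ(μ̄(T), ν(T)) - β ℋ(ν(T)) - (1/T) ∫_0^T ℒ(μ(t), ν(t)) dt + β ℋ(ν̄(T))`,
as an extended real number. -/
def dualPotential {Θ 𝒴 : Type*} [MeasurableSpace Θ] {N d : ℕ} (ℓ : Θ → (Fin d → ℝ) × 𝒴 → ℝ)
    (x : Fin N → Fin d → ℝ) (y : Fin N → 𝒴) (ε β : ℝ)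
    (μ : ℝ → Measure Θ) (ν : ℝ → Fin N → Measure (Fin d → ℝ)) (T : ℝ) : EReal :=
  regPayoff ℓ x y ε β (timeAverage μ T) (ν T)
    - ((T⁻¹ * ∫ t in (0 : ℝ)..T, payoff ℓ y (μ t) (ν t) : ℝ) : EReal)
    + (β : EReal) *
      ((regularizer x ε (fun i => timeAverage (fun s => ν s i) T) : ℝ≥0∞) : EReal)

end RandomizedAT

end

/-!
The estimate concerns the attacker only: for any measurable curve of classifiers, entropic best
responses to the running average have a scaled dual potential `t ℛ_ν(t)` that never exceeds its
value at time `1`.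

For the `i`-th data point let `u` be the uniform distribution on the ball, let
`a_s(x') = β⁻¹ 𝔼_{θ ∼ μ(s)} ℓ(θ, (x', y_i))` and let `A_t = (1/t) ∫_0^t a_s ds`. By the Gibbs
variational principle (`toReal_klDiv_eq_add_tilted`) the best response at time `t ≥ 1` is unique
and equals the exponential tilt of `u` by `A_t`, with optimal value `β log ∫ exp(A_t) du`
(`IsLogitBestResponse.eq_tilted`, `regPayoff_bestResponse`). In particular the best responses
form a measurable curve with bounded entropy, which gives the integrability and finiteness claims.

The decay combines two facts.

* Envelope (`mul_log_integral_exp_le`): `t log ∫ exp(A_t) du` is the maximum over `ρ` of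
  `∫ (∫_0^t a_s ds) dρ - t KL(ρ ‖ u)`, so between times `1` and `T` it grows by at most
  `∫_1^T (∫ a_s dν_i(s) - KL(ν_i(s) ‖ u)) ds`. This is proved by comparing the problems at nearby
  times `s ≤ t` through the competitor `ν_i(t)`. The tilts depend on time in a Lipschitz way, so
  the error on `[s, t]` is of second order in `t - s` and disappears under refinement
  (`le_of_increment_le`); no differentiability of `A_t` is needed.
* Convexity (`klDiv_timeAverage_le`): `T KL(ν̄_i(T) ‖ u) ≤ KL(ν⁰_i ‖ u) + ∫_1^T KL(ν_i(s) ‖ u) ds`.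
  This is the data processing inequality for forgetting the time in the joint law of a uniform
  time and a sample (`klDiv_bind_withDensity_le`).

Adding them, the running entropies cancel (`regret_le_regret_one`). Multiplying by `β` and averaging
over the data points yields `t ℛ_ν(t) ≤ ℛ_ν(1)` when the initial entropy is finite; otherwise
`ℛ_ν(1) = ∞` and there is nothing to prove.
-/

noncomputable section

namespace RandomizedAT

open InformationTheory ProbabilityTheory Filter

/-! ### Entropy and exponential tilting -/

section Tilting

variable {X : Type*} [MeasurableSpace X] {u ρ : Measure X} {A : X → ℝ} {M : ℝ}

lemma integrable_of_mem_Icc [IsFiniteMeasure u] (hA : Measurable A)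
    (hM : ∀ x, A x ∈ Icc 0 M) : Integrable A u :=
  Integrable.of_bound hA.aestronglyMeasurable M
    (ae_of_all _ fun x => by rw [Real.norm_of_nonneg (hM x).1]; exact (hM x).2)

lemma integrable_exp_of_mem_Icc [IsFiniteMeasure u] (hA : Measurable A)
    (hM : ∀ x, A x ∈ Icc 0 M) : Integrable (fun x => Real.exp (A x)) u :=
  Integrable.of_bound hA.exp.aestronglyMeasurable (Real.exp M)
    (ae_of_all _ fun x => by
      rw [Real.norm_of_nonneg (Real.exp_pos _).le]; exact Real.exp_le_exp.2 (hM x).2)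

lemma integral_mem_Icc [IsProbabilityMeasure u] (hA : Measurable A) (hM : ∀ x, A x ∈ Icc 0 M) :
    ∫ x, A x ∂u ∈ Icc 0 M := by
  refine ⟨integral_nonneg fun x => (hM x).1, ?_⟩
  simpa using integral_mono (integrable_of_mem_Icc hA hM) (integrable_const (μ := u) M)
    fun x => (hM x).2

/-- The Gibbs variational identity: `∫ A dρ - KL(ρ ‖ u)` falls short of `log ∫ exp(A) du` exactly
by the relative entropy of `ρ` with respect to the tilted measure. -/
lemma toReal_klDiv_eq_add_tilted [IsProbabilityMeasure u] [IsProbabilityMeasure ρ]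
    (hA : Measurable A) (hM : ∀ x, A x ∈ Icc 0 M) (h : klDiv ρ u ≠ ⊤) :
    klDiv ρ (u.tilted A) ≠ ⊤ ∧
      (klDiv ρ u).toReal = (klDiv ρ (u.tilted A)).toReal + ∫ x, A x ∂ρ
        - Real.log (∫ x, Real.exp (A x) ∂u) := by
  obtain ⟨hac, hint⟩ := klDiv_ne_top_iff.1 h
  have hexp := integrable_exp_of_mem_Icc (u := u) hA hM
  have hAρ := integrable_of_mem_Icc (u := ρ) hA hM
  have : IsProbabilityMeasure (u.tilted A) := isProbabilityMeasure_tilted hexp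
  have hac' : ρ ≪ u.tilted A := hac.trans (absolutelyContinuous_tilted hexp)
  refine ⟨klDiv_ne_top hac' (integrable_llr_tilted_right hac hAρ hint hexp), ?_⟩
  rw [toReal_klDiv_of_measure_eq hac (by simp), toReal_klDiv_of_measure_eq hac' (by simp),
    integral_llr_tilted_right hac hAρ hexp hint]
  ring

lemma klDiv_tilted_ne_top [IsProbabilityMeasure u]
    (hA : Measurable A) (hM : ∀ x, A x ∈ Icc 0 M) : klDiv (u.tilted A) u ≠ ⊤ := by
  have hexp := integrable_exp_of_mem_Icc (u := u) hA hM
  have : IsProbabilityMeasure (u.tilted A) := isProbabilityMeasure_tilted hexp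
  refine klDiv_ne_top (tilted_absolutelyContinuous u A) ?_
  have hae := (tilted_absolutelyContinuous u A).ae_le (log_rnDeriv_tilted_left_self hexp)
  exact (integrable_congr hae).2
    ((integrable_of_mem_Icc hA hM).sub (integrable_const _))

lemma toReal_klDiv_tilted [IsProbabilityMeasure u]
    (hA : Measurable A) (hM : ∀ x, A x ∈ Icc 0 M) :
    (klDiv (u.tilted A) u).toReal
      = ∫ x, A x ∂(u.tilted A) - Real.log (∫ x, Real.exp (A x) ∂u) := by
  have hexp := integrable_exp_of_mem_Icc (u := u) hA hM
  have : IsProbabilityMeasure (u.tilted A) := isProbabilityMeasure_tilted hexp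
  simpa using (toReal_klDiv_eq_add_tilted hA hM (klDiv_tilted_ne_top hA hM)).2

lemma log_integral_exp_le_add [IsProbabilityMeasure u] {B : X → ℝ} {δ : ℝ}
    (hA : Measurable A) (hM : ∀ x, A x ∈ Icc 0 M) (hB : Measurable B)
    (hMB : ∀ x, B x ∈ Icc 0 M) (h : ∀ x, B x ≤ A x + δ) :
    Real.log (∫ x, Real.exp (B x) ∂u) ≤ Real.log (∫ x, Real.exp (A x) ∂u) + δ := by
  have hexpA := integrable_exp_of_mem_Icc (u := u) hA hM
  have hexpB := integrable_exp_of_mem_Icc (u := u) hB hMB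
  rw [← Real.log_exp δ, ← Real.log_mul (integral_exp_pos hexpA).ne' (Real.exp_pos _).ne']
  refine Real.log_le_log (integral_exp_pos hexpB) ?_
  rw [← integral_mul_const]
  refine integral_mono hexpB (hexpA.mul_const _) fun x => ?_
  simp only [← Real.exp_add]
  exact Real.exp_le_exp.2 (h x)

/-- Uniformly close exponents have tilted measures with a density ratio close to one. -/
lemma integral_tilted_le_exp_mul [IsProbabilityMeasure u] {B h : X → ℝ} {δ : ℝ}
    (hA : Measurable A) (hM : ∀ x, A x ∈ Icc 0 M) (hB : Measurable B)
    (hMB : ∀ x, B x ∈ Icc 0 M) (hAB : ∀ x, |A x - B x| ≤ δ)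
    (hh : Measurable h) (hhM : ∀ x, h x ∈ Icc 0 M) :
    ∫ x, h x ∂(u.tilted B) ≤ Real.exp (2 * δ) * ∫ x, h x ∂(u.tilted A) := by
  have hexpA := integrable_exp_of_mem_Icc (u := u) hA hM
  have hexpB := integrable_exp_of_mem_Icc (u := u) hB hMB
  have hZA := integral_exp_pos hexpA
  have hZB := integral_exp_pos hexpB
  have hZ : ∫ x, Real.exp (A x) ∂u ≤ Real.exp δ * ∫ x, Real.exp (B x) ∂u := by
    rw [← integral_const_mul]
    refine integral_mono hexpA (hexpB.const_mul _) fun x => ?_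
    simp only [← Real.exp_add]
    exact Real.exp_le_exp.2 (by linarith [(abs_le.1 (hAB x)).2])
  have hI : ∀ C : X → ℝ, Measurable C → (∀ x, C x ∈ Icc 0 M) →
      Integrable (fun x => (Real.exp (C x) / ∫ x, Real.exp (C x) ∂u) * h x) u := by
    intro C hC hMC
    refine ((integrable_exp_of_mem_Icc hC hMC).div_const _).mul_bdd (c := M)
      hh.aestronglyMeasurable (ae_of_all _ fun x => ?_)
    rw [Real.norm_of_nonneg (hhM x).1]; exact (hhM x).2
  rw [integral_tilted, integral_tilted, ← integral_const_mul]
  simp only [smul_eq_mul]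
  refine integral_mono (hI B hB hMB) ((hI A hA hM).const_mul _) fun x => ?_
  simp only
  rw [← mul_assoc]
  refine mul_le_mul_of_nonneg_right ?_ (hhM x).1
  rw [mul_div_assoc', div_le_div_iff₀ hZB hZA]
  have hx : Real.exp (B x) ≤ Real.exp δ * Real.exp (A x) := by
    rw [← Real.exp_add]
    exact Real.exp_le_exp.2 (by linarith [(abs_le.1 (hAB x)).1])
  calc Real.exp (B x) * ∫ x, Real.exp (A x) ∂u
      ≤ (Real.exp δ * Real.exp (A x)) * (Real.exp δ * ∫ x, Real.exp (B x) ∂u) := by gcongr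
    _ = _ := by rw [two_mul, Real.exp_add]; ring

/-- A jointly measurable family of exponents yields a measurable family of tilted measures. -/
lemma measurable_tilted {S : Type*} [MeasurableSpace S] [SFinite u] {A : S → X → ℝ}
    (hA : Measurable (Function.uncurry A)) : Measurable fun s => u.tilted (A s) := by
  have hZ : Measurable fun s => ∫ x, Real.exp (A s x) ∂u :=
    (hA.exp.stronglyMeasurable.integral_prod_right' (ν := u)).measurable
  exact measurable_withDensity (hA.exp.div (hZ.comp measurable_fst)).ennreal_ofReal

end Tilting

/-! ### Convexity of the relative entropy along mixtures -/

/-- Relative entropy is convex along arbitrary measurable mixtures. This is the data processing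
inequality for the second projection, applied to the joint law of parameter and sample. -/
lemma klDiv_bind_withDensity_le {S X : Type*} [MeasurableSpace S] [MeasurableSpace X]
    (P : Measure S) [IsProbabilityMeasure P] (u : Measure X) [IsProbabilityMeasure u]
    {f : S → X → ℝ≥0∞} (hf : Measurable (Function.uncurry f)) (hf1 : ∀ s, ∫⁻ x, f s x ∂u = 1) :
    klDiv (P.bind fun s => u.withDensity (f s)) u
      ≤ ∫⁻ s, klDiv (u.withDensity (f s)) u ∂P := by
  have hfs : ∀ s, Measurable (f s) := fun s => hf.comp measurable_prodMk_left
  have hprob : ∀ s, IsProbabilityMeasure (u.withDensity (f s)) := fun s =>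
    ⟨by rw [withDensity_apply _ MeasurableSet.univ, setLIntegral_univ, hf1]⟩
  have hkl : ∀ s, klDiv (u.withDensity (f s)) u
      = ∫⁻ x, ENNReal.ofReal (klFun (f s x).toReal) ∂u := by
    intro s
    have := hprob s
    rw [klDiv_eq_lintegral_klFun_of_ac (withDensity_absolutelyContinuous _ _)]
    refine lintegral_congr_ae ?_
    filter_upwards [Measure.rnDeriv_withDensity u (hfs s)] with x hx
    rw [hx]
  let Q : Measure (S × X) := (P.prod u).withDensity (Function.uncurry f)
  have hQ : IsProbabilityMeasure Q := ⟨by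
    rw [withDensity_apply _ MeasurableSet.univ, setLIntegral_univ, lintegral_prod _ hf.aemeasurable]
    simp [Function.uncurry, hf1]⟩
  have hmeas : Measurable fun s => u.withDensity (f s) := measurable_withDensity hf
  have hmap : Q.map Prod.snd = P.bind fun s => u.withDensity (f s) := by
    ext E hE
    rw [Measure.map_apply measurable_snd hE, Measure.bind_apply hE hmeas.aemeasurable,
      withDensity_apply _ (measurable_snd hE), ← lintegral_indicator (measurable_snd hE),
      lintegral_prod _ (hf.indicator (measurable_snd hE)).aemeasurable]
    refine lintegral_congr fun s => ?_
    rw [withDensity_apply _ hE, ← lintegral_indicator hE]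
    rfl
  calc klDiv (P.bind fun s => u.withDensity (f s)) u
      = klDiv (Q.map Prod.snd) ((P.prod u).map Prod.snd) := by
        rw [hmap, Measure.map_snd_prod]; simp
    _ ≤ klDiv Q (P.prod u) := klDiv_map_le _ _ measurable_snd
    _ = ∫⁻ p, ENNReal.ofReal (klFun (Function.uncurry f p).toReal) ∂(P.prod u) := by
        rw [klDiv_eq_lintegral_klFun_of_ac (withDensity_absolutelyContinuous _ _)]
        refine lintegral_congr_ae ?_
        filter_upwards [Measure.rnDeriv_withDensity (P.prod u) hf] with x hx
        rw [hx]
    _ = ∫⁻ s, klDiv (u.withDensity (f s)) u ∂P := by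
        have hm : Measurable fun p => ENNReal.ofReal (klFun (Function.uncurry f p).toReal) :=
          (measurable_klFun.comp hf.ennreal_toReal).ennreal_ofReal
        rw [lintegral_prod _ hm.aemeasurable]
        exact lintegral_congr fun s => (hkl s).symm

/-! ### The envelope inequality for the logit best response -/

/-- A function on `[1, ∞)` whose increments over short intervals are bounded above by a
quantity of smaller order than the length does not increase. -/
lemma le_of_increment_le {D w : ℝ → ℝ} (hw : Tendsto w (nhds 0) (nhds 0))
    (hD : ∀ s t, 1 ≤ s → s ≤ t → D t - D s ≤ (t - s) * w (t - s)) {T : ℝ} (hT : 1 ≤ T) :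
    D T ≤ D 1 := by
  have hbound : ∀ n : ℕ, D T - D 1 ≤ (T - 1) * w ((T - 1) / (n + 1 : ℕ)) := by
    intro n
    set m : ℕ := n + 1 with hm
    have hm0 : (0 : ℝ) < (m : ℝ) := by positivity
    set h : ℝ := (T - 1) / m with hh
    have hh0 : 0 ≤ h := div_nonneg (by linarith) hm0.le
    have hmh : m * h = T - 1 := by rw [hh]; field_simp
    have hsum := Finset.sum_range_sub (fun k : ℕ => D (1 + k * h)) m
    simp only [hmh, Nat.cast_zero, zero_mul, add_zero, add_sub_cancel] at hsum
    rw [← hsum]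
    calc ∑ k ∈ Finset.range m, (D (1 + (k + 1 : ℕ) * h) - D (1 + k * h))
        ≤ ∑ _k ∈ Finset.range m, h * w h := by
          refine Finset.sum_le_sum fun k _ => ?_
          have := hD (1 + k * h) (1 + (k + 1 : ℕ) * h) (by nlinarith [k.cast_nonneg (α := ℝ)])
            (by push_cast; nlinarith)
          have heq : 1 + ((k + 1 : ℕ) : ℝ) * h - (1 + k * h) = h := by push_cast; ring
          rwa [heq] at this
      _ = (T - 1) * w h := by
          rw [Finset.sum_const, Finset.card_range, nsmul_eq_mul, ← mul_assoc, hmh]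
  have hlim : Tendsto (fun n : ℕ => (T - 1) * w ((T - 1) / (n + 1 : ℕ))) atTop
      (nhds ((T - 1) * 0)) := by
    refine (hw.comp ?_).const_mul _
    exact (tendsto_const_div_atTop_nhds_zero_nat (T - 1)).comp (tendsto_add_atTop_nat 1)
  have := ge_of_tendsto' hlim hbound
  linarith

/-- The running time average `(1/t) ∫_0^t a_s(x) ds` of a curve of functions; it vanishes for
`t ≤ 0`. -/
def runningMean {X : Type*} (a : ℝ → X → ℝ) (t : ℝ) (x : X) : ℝ :=
  t⁻¹ * ∫ s in Ioc 0 t, a s x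

lemma runningMean_eq {X : Type*} (a : ℝ → X → ℝ) {t : ℝ} (ht : 0 ≤ t) (x : X) :
    runningMean a t x = t⁻¹ * ∫ s in (0 : ℝ)..t, a s x := by
  rw [runningMean, intervalIntegral.integral_of_le ht]

lemma intervalIntegrable_of_mem_Icc {F : ℝ → ℝ} {M : ℝ} (hF : Measurable F)
    (hM : ∀ s, F s ∈ Icc 0 M) (s t : ℝ) : IntervalIntegrable F volume s t :=
  (intervalIntegrable_const (c := M)).mono_fun hF.aestronglyMeasurable
    (ae_of_all _ fun r => by
      simp only
      rw [Real.norm_of_nonneg (hM r).1, Real.norm_of_nonneg ((hM r).1.trans (hM r).2)]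
      exact (hM r).2)

section Envelope

variable {X : Type*} [MeasurableSpace X] {a : ℝ → X → ℝ} {M : ℝ}

lemma measurable_runningMean (ha : Measurable (Function.uncurry a)) :
    Measurable (Function.uncurry (runningMean a)) := by
  have hset : MeasurableSet {q : (ℝ × X) × ℝ | q.2 ∈ Ioc 0 q.1.1} :=
    (measurableSet_lt measurable_const measurable_snd).inter
      (measurableSet_le measurable_snd (measurable_fst.comp measurable_fst))
  have hq : Measurable fun q : (ℝ × X) × ℝ => a q.2 q.1.2 :=
    ha.comp (measurable_snd.prodMk (measurable_snd.comp measurable_fst))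
  have h := ((hq.indicator hset).stronglyMeasurable.integral_prod_right'
    (ν := (volume : Measure ℝ))).measurable
  convert! measurable_fst.inv.mul h using 1
  funext p
  change p.1⁻¹ * _ = p.1⁻¹ * _
  rw [← integral_indicator measurableSet_Ioc]
  rfl

variable (ha : Measurable (Function.uncurry a)) (hM : ∀ s x, a s x ∈ Icc 0 M)

include ha hM

lemma runningMean_mem_Icc (t : ℝ) (x : X) : runningMean a t x ∈ Icc 0 M := by
  have hM0 : 0 ≤ M := (hM 0 x).1.trans (hM 0 x).2
  rcases le_or_gt t 0 with ht | ht
  · simp [runningMean, Ioc_eq_empty_of_le ht, hM0]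
  · have hI := intervalIntegrable_of_mem_Icc (ha.comp measurable_prodMk_right)
      (fun s => hM s x) 0 t
    rw [runningMean_eq a ht.le]
    constructor
    · exact mul_nonneg (inv_nonneg.2 ht.le)
        (intervalIntegral.integral_nonneg ht.le fun s _ => (hM s x).1)
    · rw [inv_mul_le_iff₀ ht]
      simpa using intervalIntegral.integral_mono_on ht.le hI intervalIntegrable_const
        fun s _ => (hM s x).2

lemma mul_runningMean_sub {s t : ℝ} (hs : 0 < s) (hst : s ≤ t) (x : X) :
    t * runningMean a t x - s * runningMean a s x = ∫ r in s..t, a r x := by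
  have hI := intervalIntegrable_of_mem_Icc (F := fun r => a r x) (ha.comp measurable_prodMk_right)
    (fun s => hM s x)
  rw [runningMean_eq a hs.le, runningMean_eq a (hs.le.trans hst),
    mul_inv_cancel_left₀ (hs.trans_le hst).ne', mul_inv_cancel_left₀ hs.ne']
  exact intervalIntegral.integral_interval_sub_left (hI _ _) (hI _ _)

lemma abs_runningMean_sub_le {s t : ℝ} (hs : 1 ≤ s) (hst : s ≤ t) (x : X) :
    |runningMean a t x - runningMean a s x| ≤ M * (t - s) := by
  have hs0 : 0 < s := by linarith
  have h := mul_runningMean_sub ha hM hs0 hst x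
  have hI := intervalIntegrable_of_mem_Icc (ha.comp measurable_prodMk_right)
      (fun s => hM s x) s t
  have h0 : 0 ≤ ∫ r in s..t, a r x :=
    intervalIntegral.integral_nonneg hst fun s _ => (hM s x).1
  have h1 : ∫ r in s..t, a r x ≤ (t - s) * M := by
    simpa using intervalIntegral.integral_mono_on hst hI intervalIntegrable_const
        fun s _ => (hM s x).2
  obtain ⟨hs1, hs2⟩ := runningMean_mem_Icc ha hM s x
  have hm : 0 ≤ (t - s) * runningMean a s x := mul_nonneg (by linarith) hs1
  have hm' : (t - s) * runningMean a s x ≤ (t - s) * M :=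
    mul_le_mul_of_nonneg_left hs2 (by linarith)
  have hB : 0 ≤ (t - s) * M := hm.trans hm'
  -- `t (A_t - A_s)` is the difference of two terms of `[0, M (t - s)]`
  have hkey : |t * (runningMean a t x - runningMean a s x)| ≤ M * (t - s) := by
    rw [abs_le]; constructor <;> linarith
  rw [abs_mul, abs_of_pos (by linarith : 0 < t)] at hkey
  exact (le_mul_of_one_le_left (abs_nonneg _) (hs.trans hst)).trans hkey

variable (u : Measure X) [IsProbabilityMeasure u]

lemma isProbabilityMeasure_tilted_runningMean (t : ℝ) :
    IsProbabilityMeasure (u.tilted (runningMean a t)) :=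
  isProbabilityMeasure_tilted (integrable_exp_of_mem_Icc
    ((measurable_runningMean ha).comp measurable_prodMk_left) (runningMean_mem_Icc ha hM t))

lemma measurable_integral_tilted_runningMean {b : ℝ → X → ℝ}
    (hb : Measurable (Function.uncurry b)) :
    Measurable fun s => ∫ x, b s x ∂(u.tilted (runningMean a s)) := by
  let τ : Kernel ℝ X := ⟨fun s => u.tilted (runningMean a s),
    measurable_tilted (measurable_runningMean ha)⟩
  have : IsMarkovKernel τ := ⟨isProbabilityMeasure_tilted_runningMean ha hM u⟩
  exact (hb.stronglyMeasurable.integral_kernel_prod_right' (κ := τ)).measurable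

lemma toReal_klDiv_tilted_runningMean (t : ℝ) :
    (klDiv (u.tilted (runningMean a t)) u).toReal
      = ∫ x, runningMean a t x ∂(u.tilted (runningMean a t))
        - Real.log (∫ x, Real.exp (runningMean a t x) ∂u) :=
  toReal_klDiv_tilted ((measurable_runningMean ha).comp measurable_prodMk_left)
    (runningMean_mem_Icc ha hM t)

lemma measurable_toReal_klDiv_tilted_runningMean :
    Measurable fun s => (klDiv (u.tilted (runningMean a s)) u).toReal := by
  simp only [toReal_klDiv_tilted_runningMean ha hM u]
  refine (measurable_integral_tilted_runningMean ha hM u (measurable_runningMean ha)).sub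
    (Measurable.log ?_)
  exact ((measurable_runningMean ha).exp.stronglyMeasurable.integral_prod_right'
    (ν := u)).measurable

lemma toReal_klDiv_tilted_runningMean_mem_Icc (t : ℝ) :
    (klDiv (u.tilted (runningMean a t)) u).toReal ∈ Icc 0 M := by
  refine ⟨ENNReal.toReal_nonneg, ?_⟩
  have := isProbabilityMeasure_tilted_runningMean ha hM u t
  have hA : Measurable (runningMean a t) := (measurable_runningMean ha).comp measurable_prodMk_left
  have hAM := runningMean_mem_Icc ha hM t
  rw [toReal_klDiv_tilted_runningMean ha hM u]
  have h0 : 0 ≤ Real.log (∫ x, Real.exp (runningMean a t x) ∂u) := by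
    refine Real.log_nonneg ?_
    simpa using integral_mono (integrable_const (μ := u) (1 : ℝ))
      (integrable_exp_of_mem_Icc hA hAM) fun x => Real.one_le_exp (hAM x).1
  linarith [(integral_mem_Icc (u := u.tilted (runningMean a t)) hA hAM).2]

/-- The tilted measure at the later time is an admissible competitor in the Gibbs variational
principle at the earlier time. -/
lemma mul_log_integral_exp_sub_le {s t : ℝ} (hs : 0 < s) (hst : s ≤ t) :
    t * Real.log (∫ x, Real.exp (runningMean a t x) ∂u)
        - s * Real.log (∫ x, Real.exp (runningMean a s x) ∂u)
      ≤ ∫ r in s..t, (∫ x, a r x ∂(u.tilted (runningMean a t))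
          - (klDiv (u.tilted (runningMean a t)) u).toReal) := by
  have hA : ∀ t, Measurable (runningMean a t) := fun t =>
    (measurable_runningMean ha).comp measurable_prodMk_left
  have hAM := runningMean_mem_Icc ha hM
  have := isProbabilityMeasure_tilted_runningMean ha hM u t
  set τ := u.tilted (runningMean a t) with hτ
  have ht := toReal_klDiv_tilted_runningMean ha hM u t
  have hsle := (toReal_klDiv_eq_add_tilted (ρ := τ) (hA s) (hAM s)
    (klDiv_tilted_ne_top (hA t) (hAM t))).2
  have hnn : 0 ≤ (klDiv τ (u.tilted (runningMean a s))).toReal := ENNReal.toReal_nonneg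
  rw [← hτ] at ht
  have hmeas : Measurable fun r => ∫ x, a r x ∂τ :=
    (ha.stronglyMeasurable.integral_prod_right' (ν := τ)).measurable
  have hI := intervalIntegrable_of_mem_Icc hmeas (fun r => integral_mem_Icc
    (ha.comp (measurable_prodMk_left (x := r))) (hM r)) s t
  have hswap : ∫ r in s..t, ∫ x, a r x ∂τ
      = t * ∫ x, runningMean a t x ∂τ - s * ∫ x, runningMean a s x ∂τ := by
    rw [← integral_const_mul, ← integral_const_mul, ← integral_sub
      ((integrable_of_mem_Icc (hA t) (hAM t)).const_mul _)
      ((integrable_of_mem_Icc (hA s) (hAM s)).const_mul _)]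
    simp only [mul_runningMean_sub ha hM hs hst]
    simp only [intervalIntegral.integral_of_le hst]
    refine integral_integral_swap ?_
    exact integrable_of_mem_Icc ha fun p => hM p.1 p.2
  rw [intervalIntegral.integral_sub hI intervalIntegrable_const, hswap,
    intervalIntegral.integral_const, smul_eq_mul]
  nlinarith

/-- The integrated envelope theorem: the scaled log-partition function `t log ∫ exp(A_t) du`,
which is the maximal value of `ρ ↦ ∫ (∫_0^t a_s ds) dρ - t KL(ρ ‖ u)`, grows at most at the rate
of the objective at the current maximizer. -/
lemma mul_log_integral_exp_le {T : ℝ} (hT : 1 ≤ T) :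
    T * Real.log (∫ x, Real.exp (runningMean a T x) ∂u)
      ≤ Real.log (∫ x, Real.exp (runningMean a 1 x) ∂u)
        + ∫ r in (1 : ℝ)..T, (∫ x, a r x ∂(u.tilted (runningMean a r))
          - (klDiv (u.tilted (runningMean a r)) u).toReal) := by
  have hA : ∀ t, Measurable (runningMean a t) := fun t =>
    (measurable_runningMean ha).comp measurable_prodMk_left
  have hAM := runningMean_mem_Icc ha hM
  have hprob := isProbabilityMeasure_tilted_runningMean ha hM u
  have har : ∀ r, Measurable (a r) := fun r => ha.comp measurable_prodMk_left
  have hI : ∀ s t, IntervalIntegrable (fun r => ∫ x, a r x ∂(u.tilted (runningMean a r))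
      - (klDiv (u.tilted (runningMean a r)) u).toReal) volume s t := fun s t =>
    (intervalIntegrable_of_mem_Icc (measurable_integral_tilted_runningMean ha hM u ha)
      (fun r => integral_mem_Icc (har r) (hM r)) s t).sub
    (intervalIntegrable_of_mem_Icc (measurable_toReal_klDiv_tilted_runningMean ha hM u)
      (toReal_klDiv_tilted_runningMean_mem_Icc ha hM u) s t)
  let w : ℝ → ℝ := fun h => 2 * M * (Real.exp (2 * (M * h)) - 1) + 2 * (M * h)
  have hw : Tendsto w (nhds 0) (nhds 0) := by
    have hc : Continuous w := by fun_prop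
    simpa [w] using hc.tendsto 0
  let D : ℝ → ℝ := fun t => t * Real.log (∫ x, Real.exp (runningMean a t x) ∂u)
    - ∫ r in (1 : ℝ)..t, (∫ x, a r x ∂(u.tilted (runningMean a r))
          - (klDiv (u.tilted (runningMean a r)) u).toReal)
  have hD : D T ≤ D 1 := by
    refine le_of_increment_le hw (fun s t hs hst => ?_) hT
    have hstep := mul_log_integral_exp_sub_le ha hM u (by linarith : 0 < s) hst
    have hmeas : Measurable fun r => ∫ x, a r x ∂(u.tilted (runningMean a t)) :=
      (ha.stronglyMeasurable.integral_prod_right' (ν := u.tilted (runningMean a t))).measurable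
    -- replacing the tilt at time `t` by the one at time `r ∈ [s, t]` costs at most `w (t - s)`
    have hmono : ∫ r in s..t, (∫ x, a r x ∂(u.tilted (runningMean a t))
          - (klDiv (u.tilted (runningMean a t)) u).toReal)
        ≤ ∫ r in s..t, ((∫ x, a r x ∂(u.tilted (runningMean a r))
          - (klDiv (u.tilted (runningMean a r)) u).toReal) + w (t - s)) := by
      refine intervalIntegral.integral_mono_on hst
        ((intervalIntegrable_of_mem_Icc hmeas (fun r => integral_mem_Icc (har r) (hM r))
          s t).sub intervalIntegrable_const) ((hI s t).add intervalIntegrable_const) ?_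
      intro r hr
      have hδ : ∀ x, |runningMean a t x - runningMean a r x| ≤ M * (t - s) := fun x => by
        have hM0 : 0 ≤ M := (hM 0 x).1.trans (hM 0 x).2
        exact (abs_runningMean_sub_le ha hM (hs.trans hr.1) hr.2 x).trans
          (mul_le_mul_of_nonneg_left (by linarith [hr.1]) hM0)
      have hδ' : ∀ x, |runningMean a r x - runningMean a t x| ≤ M * (t - s) := fun x => by
        rw [abs_sub_comm]; exact hδ x
      have hne : Nonempty X := nonempty_of_isProbabilityMeasure u
      have hM0 : 0 ≤ M * (t - s) := (abs_nonneg _).trans (hδ hne.some)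
      have he : 0 ≤ Real.exp (2 * (M * (t - s))) - 1 := by
        linarith [Real.one_le_exp (by linarith : 0 ≤ 2 * (M * (t - s)))]
      have h1 := integral_tilted_le_exp_mul (u := u) (hA r) (hAM r) (hA t) (hAM t) hδ'
        (har r) (hM r)
      have h2 := integral_tilted_le_exp_mul (u := u) (hA t) (hAM t) (hA r) (hAM r) hδ
        (hA r) (hAM r)
      have h3 := log_integral_exp_le_add (u := u) (δ := M * (t - s)) (hA r) (hAM r) (hA t) (hAM t)
        fun x => by linarith [(abs_le.1 (hδ x)).2]
      have h4 := (integral_mem_Icc (u := u.tilted (runningMean a r)) (har r) (hM r)).2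
      have h5 := (integral_mem_Icc (u := u.tilted (runningMean a t)) (hA r) (hAM r)).2
      have h6 : ∫ x, runningMean a r x ∂(u.tilted (runningMean a t))
          ≤ ∫ x, runningMean a t x ∂(u.tilted (runningMean a t)) + M * (t - s) := by
        have := integral_mono (μ := u.tilted (runningMean a t))
          (integrable_of_mem_Icc (hA r) (hAM r))
          ((integrable_of_mem_Icc (hA t) (hAM t)).add (integrable_const (M * (t - s))))
          fun x => by
            have := (abs_le.1 (hδ' x)).2
            simp only [Pi.add_apply]; linarith
        simpa [integral_add (integrable_of_mem_Icc (hA t) (hAM t)) (integrable_const _)] using this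
      rw [toReal_klDiv_tilted_runningMean ha hM u t, toReal_klDiv_tilted_runningMean ha hM u r]
      have h4' := mul_le_mul_of_nonneg_left h4 he
      have h5' := mul_le_mul_of_nonneg_left h5 he
      simp only [w]
      linarith
    rw [intervalIntegral.integral_add (hI s t) intervalIntegrable_const,
      intervalIntegral.integral_const, smul_eq_mul] at hmono
    have hadj := intervalIntegral.integral_interval_sub_left (hI 1 t) (hI 1 s)
    simp only [D]
    linarith
  simp only [D, one_mul, intervalIntegral.integral_same, sub_zero] at hD
  linarith

end Envelope

/-! ### Regret of a single entropically regularized player -/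

lemma timeAverage_congr {Ω : Type*} [MeasurableSpace Ω] {m m' : ℝ → Measure Ω} {T : ℝ}
    (h : ∀ᵐ s ∂(volume.restrict (Ioc 0 T)), m s = m' s) : timeAverage m T = timeAverage m' T := by
  rw [timeAverage, timeAverage, Measure.bind_congr_right h]

/-- The uniform probability measure on the time interval `(0, T]`. -/
def uniformTime (T : ℝ) : Measure ℝ := (ENNReal.ofReal T)⁻¹ • volume.restrict (Ioc 0 T)

lemma isProbabilityMeasure_uniformTime {T : ℝ} (hT : 0 < T) :
    IsProbabilityMeasure (uniformTime T) := by
  refine ⟨?_⟩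
  simp only [uniformTime, Measure.smul_apply, Measure.restrict_apply_univ, Real.volume_Ioc,
    sub_zero, smul_eq_mul]
  exact ENNReal.inv_mul_cancel (by simpa using hT) ENNReal.ofReal_ne_top

lemma timeAverage_eq_bind {Ω : Type*} [MeasurableSpace Ω] (m : ℝ → Measure Ω) (T : ℝ) :
    timeAverage m T = (uniformTime T).bind m := by
  rw [timeAverage, uniformTime, Measure.bind_smul]

section SinglePlayer

variable {X : Type*} [MeasurableSpace X] {a : ℝ → X → ℝ} {M : ℝ} {u ρ : Measure X}
  {η : ℝ → Measure X}

lemma timeAverage_one (h0 : ∀ s, 0 ≤ s → s < 1 → η s = ρ) : timeAverage η 1 = ρ := by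
  have h : ∀ᵐ s ∂(volume.restrict (Ioc (0 : ℝ) 1)), η s = ρ := by
    rw [← restrict_Ioo_eq_restrict_Ioc]
    exact (ae_restrict_iff' measurableSet_Ioo).2 (ae_of_all _ fun s hs => h0 s hs.1.le hs.2)
  rw [timeAverage_congr h, timeAverage, Measure.bind_const]
  simp

variable [IsProbabilityMeasure u] [IsProbabilityMeasure ρ]
  (ha : Measurable (Function.uncurry a)) (hM : ∀ s x, a s x ∈ Icc 0 M)
  (h0 : ∀ s, 0 ≤ s → s < 1 → η s = ρ) (h1 : ∀ s, 1 ≤ s → η s = u.tilted (runningMean a s))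

include ha hM h0 h1

lemma intervalIntegrable_integral_of_bestResponse {p q : ℝ} (hp : 0 ≤ p) (hpq : p ≤ q) :
    IntervalIntegrable (fun s => ∫ x, a s x ∂(η s)) volume p q := by
  have har : ∀ r, Measurable (a r) := fun r => ha.comp measurable_prodMk_left
  have hmeas : Measurable fun s : ℝ => if s < 1 then ∫ x, a s x ∂ρ
      else ∫ x, a s x ∂(u.tilted (runningMean a s)) :=
    Measurable.ite measurableSet_Iio
      (ha.stronglyMeasurable.integral_prod_right' (ν := ρ)).measurable
      (measurable_integral_tilted_runningMean ha hM u ha)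
  have hint := intervalIntegrable_of_mem_Icc (M := M) hmeas (fun s => by
    have := isProbabilityMeasure_tilted_runningMean ha hM u s
    split_ifs
    exacts [integral_mem_Icc (har s) (hM s), integral_mem_Icc (har s) (hM s)]) p q
  refine hint.congr fun s hs => ?_
  rw [uIoc_of_le hpq] at hs
  split_ifs with h
  · rw [h0 s (hp.trans hs.1.le) h]
  · rw [h1 s (not_lt.1 h)]

/-- Convexity of the relative entropy along the trajectory of best responses. -/
lemma klDiv_timeAverage_le (hρ : klDiv ρ u ≠ ⊤) {T : ℝ} (hT : 1 ≤ T) :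
    klDiv (timeAverage η T) u ≤ (ENNReal.ofReal T)⁻¹ * (klDiv ρ u + ENNReal.ofReal
      (∫ s in (1 : ℝ)..T, (klDiv (u.tilted (runningMean a s)) u).toReal)) := by
  have hA := measurable_runningMean ha
  have hAt : ∀ t, Measurable (runningMean a t) := fun t => hA.comp measurable_prodMk_left
  have hZ : Measurable fun s => ∫ x, Real.exp (runningMean a s x) ∂u :=
    (hA.exp.stronglyMeasurable.integral_prod_right' (ν := u)).measurable
  -- joint density in time and space of the trajectory `η`
  let f : ℝ → X → ℝ≥0∞ := fun s x => if s < 1 then ρ.rnDeriv u x else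
    ENNReal.ofReal (Real.exp (runningMean a s x) / ∫ x, Real.exp (runningMean a s x) ∂u)
  have hf : Measurable (Function.uncurry f) := by
    refine Measurable.ite (measurableSet_lt measurable_fst measurable_const)
      ((Measure.measurable_rnDeriv ρ u).comp measurable_snd) ?_
    exact (hA.exp.div (hZ.comp measurable_fst)).ennreal_ofReal
  have hfρ : ∀ s, s < 1 → u.withDensity (f s) = ρ := fun s hs => by
    simp only [f, hs, if_true]
    exact Measure.withDensity_rnDeriv_eq _ _ (klDiv_ne_top_iff.1 hρ).1
  have hfτ : ∀ s, 1 ≤ s → u.withDensity (f s) = u.tilted (runningMean a s) := fun s hs => by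
    simp only [f, not_lt.2 hs, if_false]
    rfl
  have hprob := isProbabilityMeasure_tilted_runningMean ha hM u
  have hf1 : ∀ s, ∫⁻ x, f s x ∂u = 1 := fun s => by
    rw [← setLIntegral_univ, ← withDensity_apply _ MeasurableSet.univ]
    rcases lt_or_ge s 1 with hs | hs
    · rw [hfρ s hs, measure_univ]
    · rw [hfτ s hs, measure_univ]
  have hae : ∀ᵐ s ∂(volume.restrict (Ioc 0 T)), η s = u.withDensity (f s) :=
    (ae_restrict_iff' measurableSet_Ioc).2 (ae_of_all _ fun s hs => by
      rcases lt_or_ge s 1 with h | h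
      · rw [hfρ s h, h0 s hs.1.le h]
      · rw [hfτ s h, h1 s h])
  have := isProbabilityMeasure_uniformTime (by linarith : 0 < T)
  rw [timeAverage_congr hae, timeAverage_eq_bind]
  refine (klDiv_bind_withDensity_le (uniformTime T) u hf hf1).trans ?_
  rw [uniformTime, lintegral_smul_measure, smul_eq_mul]
  gcongr
  rw [← Ioc_union_Ioc_eq_Ioc zero_le_one hT,
    lintegral_union measurableSet_Ioc (Ioc_disjoint_Ioc_of_le le_rfl)]
  refine add_le_add ?_ ?_
  · rw [← restrict_Ioo_eq_restrict_Ioc,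
      setLIntegral_congr_fun measurableSet_Ioo fun s hs => by rw [hfρ s hs.2]]
    simp
  · rw [intervalIntegral.integral_of_le hT, ofReal_integral_eq_lintegral_ofReal
      (intervalIntegrable_of_mem_Icc (measurable_toReal_klDiv_tilted_runningMean ha hM u)
        (toReal_klDiv_tilted_runningMean_mem_Icc ha hM u) 1 T).1
      (ae_of_all _ fun s => ENNReal.toReal_nonneg)]
    refine (setLIntegral_congr_fun measurableSet_Ioc fun s hs => ?_).le
    rw [hfτ s hs.1.le, ENNReal.ofReal_toReal
      (klDiv_tilted_ne_top (hAt s) (runningMean_mem_Icc ha hM s))]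

lemma klDiv_timeAverage_ne_top (hρ : klDiv ρ u ≠ ⊤) {T : ℝ} (hT : 1 ≤ T) :
    klDiv (timeAverage η T) u ≠ ⊤ := by
  refine ne_top_of_le_ne_top (ENNReal.mul_ne_top ?_ ?_)
    (klDiv_timeAverage_le ha hM h0 h1 hρ hT)
  · simp; linarith
  · exact ENNReal.add_ne_top.2 ⟨hρ, ENNReal.ofReal_ne_top⟩

/-- The gap `t log ∫ exp(A_t) du - ∫_0^t ∫ a_s dη_s ds + t KL(η̄_t ‖ u)` is never larger than at
time `1`: the running entropies produced by the envelope inequality absorb, by convexity, the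
entropy of the time average. -/
lemma regret_le_regret_one (hρ : klDiv ρ u ≠ ⊤) {T : ℝ} (hT : 1 ≤ T) :
    T * Real.log (∫ x, Real.exp (runningMean a T x) ∂u) - (∫ s in (0 : ℝ)..T, ∫ x, a s x ∂(η s))
        + T * (klDiv (timeAverage η T) u).toReal
      ≤ Real.log (∫ x, Real.exp (runningMean a 1 x) ∂u)
        - (∫ s in (0 : ℝ)..1, ∫ x, a s x ∂(η s)) + (klDiv ρ u).toReal := by
  have har : ∀ r, Measurable (a r) := fun r => ha.comp measurable_prodMk_left
  have hprob := isProbabilityMeasure_tilted_runningMean ha hM u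
  have henv := mul_log_integral_exp_le ha hM u hT
  rw [intervalIntegral.integral_sub
    (intervalIntegrable_of_mem_Icc (measurable_integral_tilted_runningMean ha hM u ha)
      (fun r => integral_mem_Icc (har r) (hM r)) _ _)
    (intervalIntegrable_of_mem_Icc (measurable_toReal_klDiv_tilted_runningMean ha hM u)
      (toReal_klDiv_tilted_runningMean_mem_Icc ha hM u) _ _)] at henv
  have hsplit := intervalIntegral.integral_add_adjacent_intervals
    (intervalIntegrable_integral_of_bestResponse ha hM h0 h1 le_rfl zero_le_one)
    (intervalIntegrable_integral_of_bestResponse ha hM h0 h1 zero_le_one hT)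
  have hcongr : ∫ s in (1 : ℝ)..T, ∫ x, a s x ∂(η s)
      = ∫ s in (1 : ℝ)..T, ∫ x, a s x ∂(u.tilted (runningMean a s)) := by
    refine intervalIntegral.integral_congr fun s hs => ?_
    rw [uIcc_of_le hT] at hs
    rw [h1 s hs.1]
  have hK0 : 0 ≤ ∫ s in (1 : ℝ)..T, (klDiv (u.tilted (runningMean a s)) u).toReal :=
    intervalIntegral.integral_nonneg hT fun s _ => ENNReal.toReal_nonneg
  have hkl := ENNReal.toReal_mono (ENNReal.mul_ne_top (by simp; linarith)
    (ENNReal.add_ne_top.2 ⟨hρ, ENNReal.ofReal_ne_top⟩)) (klDiv_timeAverage_le ha hM h0 h1 hρ hT)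
  rw [ENNReal.toReal_mul, ENNReal.toReal_inv, ENNReal.toReal_ofReal (by linarith),
    ENNReal.toReal_add hρ ENNReal.ofReal_ne_top, ENNReal.toReal_ofReal hK0,
    ← div_eq_inv_mul, le_div_iff₀ (by linarith)] at hkl
  linarith

end SinglePlayer

/-! ### Curves of probability measures as Markov kernels -/

/-- An almost everywhere measurable curve of probability measures agrees at almost all times with
a Markov kernel. -/
lemma exists_markovKernel_ae_eq {Ω : Type*} [MeasurableSpace Ω] {m : ℝ → Measure Ω} {S : Set ℝ}
    (hS : MeasurableSet S) (hne : S.Nonempty) (hm : AEMeasurable m (volume.restrict S))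
    (hprob : ∀ t ∈ S, IsProbabilityMeasure (m t)) :
    ∃ κ : Kernel ℝ Ω, IsMarkovKernel κ ∧ ∀ᵐ t ∂(volume.restrict S), m t = κ t := by
  classical
  obtain ⟨t₀, ht₀⟩ := hne
  have := hprob t₀ ht₀
  have hE : MeasurableSet {t | hm.mk m t univ = 1} :=
    measurableSet_eq_fun ((Measure.measurable_coe MeasurableSet.univ).comp hm.measurable_mk)
      measurable_const
  refine ⟨⟨fun t => if hm.mk m t univ = 1 then hm.mk m t else m t₀,
    Measurable.ite hE hm.measurable_mk measurable_const⟩, ⟨fun t => ⟨?_⟩⟩, ?_⟩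
  · change (if hm.mk m t univ = 1 then hm.mk m t else m t₀) univ = 1
    split_ifs with h
    exacts [h, measure_univ]
  · filter_upwards [hm.ae_eq_mk, ae_restrict_mem hS] with t ht htS
    have h1 : hm.mk m t univ = 1 := by
      have := hprob t htS
      rw [← ht, measure_univ]
    change m t = if hm.mk m t univ = 1 then hm.mk m t else m t₀
    rw [if_pos h1, ht]

section TimeAverage

variable {Ω : Type*} [MeasurableSpace Ω] (κ : Kernel ℝ Ω) [IsMarkovKernel κ]

lemma isProbabilityMeasure_timeAverage {t : ℝ} (ht : 0 < t) :
    IsProbabilityMeasure (timeAverage κ t) := by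
  have := isProbabilityMeasure_uniformTime ht
  rw [timeAverage_eq_bind]
  infer_instance

lemma integral_timeAverage {g : Ω → ℝ} {M : ℝ} (hg : Measurable g) (hM : ∀ x, g x ∈ Icc 0 M)
    {t : ℝ} (ht : 0 < t) :
    ∫ x, g x ∂(timeAverage κ t) = t⁻¹ * ∫ s in Ioc 0 t, ∫ x, g x ∂(κ s) := by
  have := isProbabilityMeasure_uniformTime ht
  rw [timeAverage_eq_bind, ← Measure.snd_compProd, Measure.snd,
    integral_map measurable_snd.aemeasurable hg.aestronglyMeasurable,
    Measure.integral_compProd (f := fun p => g p.2)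
      (integrable_of_mem_Icc (hg.comp measurable_snd) fun p => hM p.2),
    uniformTime, integral_smul_measure, ENNReal.toReal_inv, ENNReal.toReal_ofReal ht.le,
    smul_eq_mul]

end TimeAverage

/-! ### The logit best response is a Gibbs measure -/

section BestResponse

variable {d : ℕ}

lemma isProbabilityMeasure_uniformBall (c : Fin d → ℝ) {ε : ℝ} (hε : 0 < ε) :
    IsProbabilityMeasure (uniformBall c ε) :=
  cond_isProbabilityMeasure_of_finite (Metric.measure_closedBall_pos volume c hε).ne'
    measure_closedBall_lt_top.ne

lemma uniformBall_compl (c : Fin d → ℝ) (ε : ℝ) :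
    uniformBall c ε (attackBall c ε)ᶜ = 0 := by
  have h : MeasurableSet (attackBall c ε) := measurableSet_closedBall
  rw [uniformBall, cond_apply h, inter_compl_self]
  simp

variable {N : ℕ} {x : Fin N → Fin d → ℝ} {ε : ℝ} {ν : Fin N → Measure (Fin d → ℝ)}

lemma regularizer_ne_top_iff (hN : 0 < N) :
    regularizer x ε ν ≠ ⊤ ↔ ∀ i, klDiv (ν i) (uniformBall (x i) ε) ≠ ⊤ := by
  have hN' : ((N : ℝ≥0∞)⁻¹) ≠ 0 := ENNReal.inv_ne_zero.2 (ENNReal.natCast_ne_top N)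
  have hN'' : ((N : ℝ≥0∞)⁻¹) ≠ ⊤ := ENNReal.inv_ne_top.2 (by simpa using hN.ne')
  rw [regularizer, ne_eq, ENNReal.mul_eq_top]
  simp [hN', hN'']

lemma coe_regularizer (hN : 0 < N) (h : regularizer x ε ν ≠ ⊤) :
    ((regularizer x ε ν : ℝ≥0∞) : EReal)
      = (((N : ℝ)⁻¹ * ∑ i, (klDiv (ν i) (uniformBall (x i) ε)).toReal : ℝ) : EReal) := by
  have h' := (regularizer_ne_top_iff hN).1 h
  rw [← EReal.coe_ennreal_toReal h, regularizer, ENNReal.toReal_mul,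
    ENNReal.toReal_sum fun i _ => h' i]
  simp

variable {Θ 𝒴 : Type*} [MeasurableSpace Θ] {ℓ : Θ → (Fin d → ℝ) × 𝒴 → ℝ} {U β : ℝ}
  (hℓ : ∀ θ p, ℓ θ p ∈ Icc 0 U)
  (hℓ_meas : ∀ b : 𝒴, Measurable (fun p : Θ × (Fin d → ℝ) => ℓ p.1 (p.2, b)))
  (y : Fin N → 𝒴) {μ : Measure Θ}

/-- The rescaled expected loss `x' ↦ β⁻¹ 𝔼_{θ ∼ μ} ℓ(θ, (x', b))` of a randomized classifier,
which is the exponent of the logit best response. -/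
def scaledLoss {Θ 𝒴 : Type*} [MeasurableSpace Θ] {d : ℕ} (ℓ : Θ → (Fin d → ℝ) × 𝒴 → ℝ) (β : ℝ)
    (b : 𝒴) (μ : Measure Θ) (x' : Fin d → ℝ) : ℝ :=
  β⁻¹ * ∫ θ, ℓ θ (x', b) ∂μ

include hℓ_meas

lemma measurable_uncurry_scaledLoss (b : 𝒴) (κ : Kernel ℝ Θ) [IsMarkovKernel κ] :
    Measurable (Function.uncurry fun s => scaledLoss ℓ β b (κ s)) := by
  have h : Measurable fun q : (ℝ × (Fin d → ℝ)) × Θ => ℓ q.2 (q.1.2, b) :=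
    (hℓ_meas b).comp (measurable_snd.prodMk (measurable_snd.comp measurable_fst))
  exact ((h.stronglyMeasurable.integral_kernel_prod_right'
    (κ := κ.comap Prod.fst measurable_fst)).measurable).const_mul β⁻¹

lemma measurable_scaledLoss (b : 𝒴) (μ : Measure Θ) [SFinite μ] :
    Measurable (scaledLoss ℓ β b μ) :=
  (((hℓ_meas b).comp measurable_swap).stronglyMeasurable.integral_prod_right'
    (ν := μ)).measurable.const_mul β⁻¹

include hℓ

lemma scaledLoss_mem_Icc (hβ : 0 < β) (b : 𝒴) (μ : Measure Θ) [IsProbabilityMeasure μ]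
    (x' : Fin d → ℝ) : scaledLoss ℓ β b μ x' ∈ Icc 0 (β⁻¹ * U) := by
  have h := integral_mem_Icc (u := μ) ((hℓ_meas b).comp (measurable_prodMk_right (y := x')))
    fun θ => hℓ θ (x', b)
  exact ⟨mul_nonneg (inv_nonneg.2 hβ.le) h.1,
    mul_le_mul_of_nonneg_left h.2 (inv_nonneg.2 hβ.le)⟩

lemma payoff_eq_sum_integral_scaledLoss (hβ : 0 < β) [IsProbabilityMeasure μ]
    (hν : ∀ i, IsProbabilityMeasure (ν i)) :
    payoff ℓ y μ ν = (N : ℝ)⁻¹ * ∑ i, β * ∫ x', scaledLoss ℓ β (y i) μ x' ∂(ν i) := by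
  rw [payoff]
  congr 1
  refine Finset.sum_congr rfl fun i _ => ?_
  have := hν i
  simp only [scaledLoss]
  rw [integral_const_mul, mul_inv_cancel_left₀ hβ.ne']
  exact integral_integral_swap
    (integrable_of_mem_Icc (hℓ_meas (y i)) fun p => hℓ p.1 (p.2, y i))

/-- The Gibbs variational principle, summed over the data points. -/
lemma regPayoff_eq_log_integral_exp_sub (hN : 0 < N) (hε : 0 < ε) (hβ : 0 < β)
    [IsProbabilityMeasure μ] (hν : ν ∈ attackerStrategies x ε) (hfin : regularizer x ε ν ≠ ⊤) :
    regPayoff ℓ x y ε β μ ν = (((N : ℝ)⁻¹ * ∑ i, β *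
      (Real.log (∫ x', Real.exp (scaledLoss ℓ β (y i) μ x') ∂(uniformBall (x i) ε))
        - (klDiv (ν i) ((uniformBall (x i) ε).tilted (scaledLoss ℓ β (y i) μ))).toReal) : ℝ)
      : EReal) := by
  have hprob := fun i => (hν i).1
  have hu := fun i => isProbabilityMeasure_uniformBall (x i) hε
  rw [regPayoff, coe_regularizer hN hfin,
    payoff_eq_sum_integral_scaledLoss hℓ hℓ_meas y hβ hprob, ← EReal.coe_mul, ← EReal.coe_sub]
  congr 1
  rw [mul_left_comm, ← mul_sub, Finset.mul_sum, ← Finset.sum_sub_distrib]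
  congr 1
  refine Finset.sum_congr rfl fun i _ => ?_
  have := (toReal_klDiv_eq_add_tilted (u := uniformBall (x i) ε) (ρ := ν i)
    (measurable_scaledLoss hℓ_meas (β := β) (y i) μ)
    (scaledLoss_mem_Icc hℓ hℓ_meas hβ (y i) μ) ((regularizer_ne_top_iff hN).1 hfin i)).2
  rw [this]
  ring

/-- The logit best response is unique: it is the exponential tilt of the uniform distribution.
Its deficit with respect to the tilt is a sum of relative entropies, all of which must vanish. -/
lemma IsLogitBestResponse.eq_tilted (hN : 0 < N) (hε : 0 < ε) (hβ : 0 < β)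
    [IsProbabilityMeasure μ] (h : IsLogitBestResponse ℓ x y ε β μ ν) :
    regularizer x ε ν ≠ ⊤ ∧
      ∀ i, ν i = (uniformBall (x i) ε).tilted (scaledLoss ℓ β (y i) μ) := by
  have hprob := fun i => (h.1 i).1
  have hu := fun i => isProbabilityMeasure_uniformBall (x i) hε
  have hAm := fun i => measurable_scaledLoss hℓ_meas (β := β) (y i) μ
  have hAM := fun i => scaledLoss_mem_Icc hℓ hℓ_meas hβ (y i) μ
  let τ : Fin N → Measure (Fin d → ℝ) :=
    fun i => (uniformBall (x i) ε).tilted (scaledLoss ℓ β (y i) μ)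
  have hτ : ∀ i, IsProbabilityMeasure (τ i) := fun i =>
    isProbabilityMeasure_tilted (integrable_exp_of_mem_Icc (hAm i) (hAM i))
  have hτS : τ ∈ attackerStrategies x ε := fun i =>
    ⟨hτ i, tilted_absolutelyContinuous _ _ (uniformBall_compl _ _)⟩
  have hτfin : regularizer x ε τ ≠ ⊤ :=
    (regularizer_ne_top_iff hN).2 fun i => klDiv_tilted_ne_top (hAm i) (hAM i)
  have hle : regPayoff ℓ x y ε β μ τ ≤ regPayoff ℓ x y ε β μ ν := h.2 hτS
  rw [regPayoff_eq_log_integral_exp_sub hℓ hℓ_meas y hN hε hβ hτS hτfin] at hle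
  have hfin : regularizer x ε ν ≠ ⊤ := by
    -- otherwise the regularized payoff of `ν` would be `-∞`
    intro htop
    rw [regPayoff, htop, EReal.coe_ennreal_top, EReal.coe_mul_top_of_pos hβ,
      sub_eq_add_neg, EReal.neg_top, EReal.add_bot] at hle
    exact (EReal.bot_lt_coe _).not_ge hle
  refine ⟨hfin, fun i => ?_⟩
  rw [regPayoff_eq_log_integral_exp_sub hℓ hℓ_meas y hN hε hβ h.1 hfin,
    EReal.coe_le_coe_iff] at hle
  have hN' : (0 : ℝ) < (N : ℝ)⁻¹ := by positivity
  have hsum := le_of_mul_le_mul_left hle hN'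
  simp only [τ, klDiv_self, ENNReal.toReal_zero, sub_zero, mul_sub, Finset.sum_sub_distrib] at hsum
  have hnn : ∀ j ∈ Finset.univ, 0 ≤ β * (klDiv (ν j) (τ j)).toReal := fun j _ =>
    mul_nonneg hβ.le ENNReal.toReal_nonneg
  have hzero := (Finset.sum_eq_zero_iff_of_nonneg hnn).1
    (le_antisymm (by simp only [τ]; linarith) (Finset.sum_nonneg hnn)) i (Finset.mem_univ i)
  have hne := (toReal_klDiv_eq_add_tilted (u := uniformBall (x i) ε) (ρ := ν i) (hAm i) (hAM i)
    ((regularizer_ne_top_iff hN).1 hfin i)).1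
  rw [mul_eq_zero, ENNReal.toReal_eq_zero_iff] at hzero
  have := hτ i
  exact klDiv_eq_zero_iff.1 ((hzero.resolve_left hβ.ne').resolve_right hne)

end BestResponse

/-! ### The dual potential along the flow -/

section DualPotential

variable {Θ 𝒴 : Type*} [MeasurableSpace Θ] {N d : ℕ} {ℓ : Θ → (Fin d → ℝ) × 𝒴 → ℝ} {U β ε : ℝ}
  {x : Fin N → Fin d → ℝ} {y : Fin N → 𝒴} {ν0 : Fin N → Measure (Fin d → ℝ)}
  {μ : ℝ → Measure Θ} {ν : ℝ → Fin N → Measure (Fin d → ℝ)} {κ : Kernel ℝ Θ} [IsMarkovKernel κ]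
  (hℓ : ∀ θ p, ℓ θ p ∈ Icc 0 U)
  (hℓ_meas : ∀ b : 𝒴, Measurable (fun p : Θ × (Fin d → ℝ) => ℓ p.1 (p.2, b)))

include hℓ hℓ_meas

lemma scaledLoss_timeAverage (b : 𝒴) {t : ℝ} (ht : 0 < t) :
    scaledLoss ℓ β b (timeAverage κ t) = runningMean (fun s => scaledLoss ℓ β b (κ s)) t := by
  funext x'
  rw [scaledLoss, integral_timeAverage κ (g := fun θ => ℓ θ (x', b))
    ((hℓ_meas b).comp (measurable_prodMk_right (y := x')))
    (fun θ => hℓ θ (x', b)) ht, runningMean, mul_left_comm, ← integral_const_mul]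
  rfl

variable (hN : 0 < N) (hε : 0 < ε) (hβ : 0 < β) (hν0 : ν0 ∈ attackerStrategies x ε)
  (hκ : ∀ᵐ t ∂(volume.restrict (Ici 0)), μ t = κ t)
  (h0 : ∀ t, 0 ≤ t → t < 1 → ν t = ν0)
  (h1 : ∀ t, 1 ≤ t → IsLogitBestResponse ℓ x y ε β (timeAverage μ t) (ν t))

omit hℓ hℓ_meas [IsMarkovKernel κ] in
include hκ in
lemma timeAverage_eq_kernel (t : ℝ) : timeAverage μ t = timeAverage κ t :=
  timeAverage_congr (ae_restrict_of_ae_restrict_of_subset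
    (fun _ hs => hs.1.le : Ioc 0 t ⊆ Ici 0) hκ)

include hN hε hβ hκ h1

lemma regularizer_ne_top_of_bestResponse {t : ℝ} (ht : 1 ≤ t) : regularizer x ε (ν t) ≠ ⊤ := by
  have := isProbabilityMeasure_timeAverage κ (by linarith : 0 < t)
  have h := h1 t ht
  rw [timeAverage_eq_kernel hκ] at h
  exact (h.eq_tilted hℓ hℓ_meas y hN hε hβ).1

lemma eq_tilted_runningMean {t : ℝ} (ht : 1 ≤ t) (i : Fin N) :
    ν t i = (uniformBall (x i) ε).tilted
      (runningMean (fun s => scaledLoss ℓ β (y i) (κ s)) t) := by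
  have := isProbabilityMeasure_timeAverage κ (by linarith : 0 < t)
  have h := h1 t ht
  rw [timeAverage_eq_kernel hκ] at h
  rw [(h.eq_tilted hℓ hℓ_meas y hN hε hβ).2 i,
    scaledLoss_timeAverage hℓ hℓ_meas (y i) (by linarith)]

lemma regPayoff_bestResponse {t : ℝ} (ht : 1 ≤ t) :
    regPayoff ℓ x y ε β (timeAverage μ t) (ν t) = (((N : ℝ)⁻¹ * ∑ i, β * Real.log
      (∫ x', Real.exp (runningMean (fun s => scaledLoss ℓ β (y i) (κ s)) t x')
        ∂(uniformBall (x i) ε)) : ℝ) : EReal) := by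
  have := isProbabilityMeasure_timeAverage κ (by linarith : 0 < t)
  have hu := fun i => isProbabilityMeasure_uniformBall (x i) hε
  have h := h1 t ht
  have htilt := eq_tilted_runningMean hℓ hℓ_meas hN hε hβ hκ h1 ht
  have hfin := regularizer_ne_top_of_bestResponse hℓ hℓ_meas hN hε hβ hκ h1 ht
  have hprob := fun i => (h.1 i).1
  rw [timeAverage_eq_kernel hκ,
    regPayoff_eq_log_integral_exp_sub hℓ hℓ_meas y hN hε hβ h.1 hfin]
  simp only [scaledLoss_timeAverage hℓ hℓ_meas _ (by linarith : 0 < t), ← htilt, klDiv_self,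
    ENNReal.toReal_zero, sub_zero]

include hν0 h0

omit hN hε in
lemma payoff_ae_eq {t : ℝ} (ht : 0 ≤ t) :
    (fun s => payoff ℓ y (μ s) (ν s)) =ᵐ[volume.restrict (uIoc 0 t)] fun s =>
      (N : ℝ)⁻¹ * ∑ i, β * ∫ x', scaledLoss ℓ β (y i) (κ s) x' ∂(ν s i) := by
  rw [uIoc_of_le ht]
  filter_upwards [ae_restrict_of_ae_restrict_of_subset
    (fun _ hs => hs.1.le : Ioc 0 t ⊆ Ici 0) hκ, ae_restrict_mem measurableSet_Ioc] with s hs hst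
  rw [hs]
  refine payoff_eq_sum_integral_scaledLoss hℓ hℓ_meas y hβ fun i => ?_
  rcases lt_or_ge s 1 with hs1 | hs1
  · rw [h0 s hst.1.le hs1]; exact (hν0 i).1
  · exact ((h1 s hs1).1 i).1

lemma intervalIntegrable_integral_scaledLoss {t : ℝ} (ht : 0 ≤ t) (i : Fin N) :
    IntervalIntegrable (fun s => ∫ x', scaledLoss ℓ β (y i) (κ s) x' ∂(ν s i)) volume 0 t := by
  have := isProbabilityMeasure_uniformBall (x i) hε
  have := (hν0 i).1
  exact intervalIntegrable_integral_of_bestResponse (η := fun s => ν s i) (ρ := ν0 i)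
    (measurable_uncurry_scaledLoss hℓ_meas (y i) κ)
    (fun s => scaledLoss_mem_Icc hℓ hℓ_meas hβ (y i) (κ s))
    (fun s hs hs1 => by simp only [h0 s hs hs1])
    (fun s hs => eq_tilted_runningMean hℓ hℓ_meas hN hε hβ hκ h1 hs i) le_rfl ht

lemma intervalIntegrable_payoff {t : ℝ} (ht : 0 ≤ t) :
    IntervalIntegrable (fun s => payoff ℓ y (μ s) (ν s)) volume 0 t := by
  refine IntervalIntegrable.congr_ae ?_
    (payoff_ae_eq hℓ hℓ_meas hβ hν0 hκ h0 h1 ht).symm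
  refine IntervalIntegrable.const_mul ?_ _
  rw [← Finset.sum_fn]
  refine IntervalIntegrable.sum _ fun i _ => ?_
  exact (intervalIntegrable_integral_scaledLoss hℓ hℓ_meas hN hε hβ hν0 hκ h0 h1 ht i).const_mul _

lemma integral_payoff_eq {t : ℝ} (ht : 0 ≤ t) :
    ∫ s in (0 : ℝ)..t, payoff ℓ y (μ s) (ν s) = (N : ℝ)⁻¹ * ∑ i, β *
      ∫ s in (0 : ℝ)..t, ∫ x', scaledLoss ℓ β (y i) (κ s) x' ∂(ν s i) := by
  rw [intervalIntegral.integral_congr_ae_restrict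
      (payoff_ae_eq hℓ hℓ_meas hβ hν0 hκ h0 h1 ht),
    intervalIntegral.integral_const_mul, intervalIntegral.integral_finsetSum fun i _ =>
      (intervalIntegrable_integral_scaledLoss hℓ hℓ_meas hN hε hβ hν0 hκ h0 h1 ht i).const_mul _]
  simp only [intervalIntegral.integral_const_mul]

lemma regularizer_timeAverage_ne_top (hfin : regularizer x ε ν0 ≠ ⊤) {t : ℝ} (ht : 1 ≤ t) :
    regularizer x ε (fun i => timeAverage (fun s => ν s i) t) ≠ ⊤ := by
  refine (regularizer_ne_top_iff hN).2 fun i => ?_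
  have := isProbabilityMeasure_uniformBall (x i) hε
  have := (hν0 i).1
  exact klDiv_timeAverage_ne_top (η := fun s => ν s i) (ρ := ν0 i)
    (measurable_uncurry_scaledLoss hℓ_meas (y i) κ)
    (fun s => scaledLoss_mem_Icc hℓ hℓ_meas hβ (y i) (κ s))
    (fun s hs hs1 => by simp only [h0 s hs hs1])
    (fun s hs => eq_tilted_runningMean hℓ hℓ_meas hN hε hβ hκ h1 hs i)
    ((regularizer_ne_top_iff hN).1 hfin i) ht

/-- Since the best response realizes the log-partition value, the dual potential is, up to the
factor `1/t`, a weighted sum of the regrets of the data points. -/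
lemma dualPotential_eq (hfin : regularizer x ε ν0 ≠ ⊤) {t : ℝ} (ht : 1 ≤ t) :
    dualPotential ℓ x y ε β μ ν t = ((t⁻¹ * ((N : ℝ)⁻¹ * ∑ i, β *
      (t * Real.log (∫ x', Real.exp (runningMean (fun s => scaledLoss ℓ β (y i) (κ s)) t x')
          ∂(uniformBall (x i) ε))
        - (∫ s in (0 : ℝ)..t, ∫ x', scaledLoss ℓ β (y i) (κ s) x' ∂(ν s i))
        + t * (klDiv (timeAverage (fun s => ν s i) t) (uniformBall (x i) ε)).toReal)) : ℝ)
      : EReal) := by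
  have ht0 : t ≠ 0 := by linarith
  rw [dualPotential, regPayoff_bestResponse hℓ hℓ_meas hN hε hβ hκ h1 ht,
    coe_regularizer hN (regularizer_timeAverage_ne_top hℓ hℓ_meas hN hε hβ hν0 hκ h0 h1 hfin ht),
    integral_payoff_eq hℓ hℓ_meas hN hε hβ hν0 hκ h0 h1 (by linarith),
    ← EReal.coe_sub, ← EReal.coe_mul, ← EReal.coe_add]
  congr 1
  simp only [mul_add, mul_sub, Finset.sum_add_distrib, Finset.sum_sub_distrib, Finset.mul_sum]
  congr 1
  · congr 1
    refine Finset.sum_congr rfl fun i _ => ?_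
    field_simp
  · refine Finset.sum_congr rfl fun i _ => ?_
    field_simp

lemma dualPotential_le_div {t : ℝ} (ht : 1 ≤ t) :
    dualPotential ℓ x y ε β μ ν t ≤ dualPotential ℓ x y ε β μ ν 1 / (t : EReal) := by
  have hstart : ∀ i, timeAverage (fun s => ν s i) 1 = ν0 i := fun i =>
    timeAverage_one fun s hs hs1 => by simp only [h0 s hs hs1]
  by_cases hfin : regularizer x ε ν0 = ⊤
  · -- an infinite initial entropy makes the right-hand side infinite
    have htop : dualPotential ℓ x y ε β μ ν 1 = ⊤ := by
      rw [dualPotential, regPayoff_bestResponse hℓ hℓ_meas hN hε hβ hκ h1 le_rfl]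
      simp only [hstart]
      rw [hfin, EReal.coe_ennreal_top, EReal.coe_mul_top_of_pos hβ, ← EReal.coe_sub,
        EReal.coe_add_top]
    rw [htop, EReal.top_div_of_pos_ne_top (by exact_mod_cast (by linarith : (0 : ℝ) < t))
      (EReal.coe_ne_top t)]
    exact le_top
  · rw [dualPotential_eq hℓ hℓ_meas hN hε hβ hν0 hκ h0 h1 hfin ht,
      dualPotential_eq hℓ hℓ_meas hN hε hβ hν0 hκ h0 h1 hfin le_rfl, ← EReal.coe_div,
      EReal.coe_le_coe_iff, inv_one, one_mul, div_eq_inv_mul]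
    have ht' : 0 ≤ t⁻¹ := inv_nonneg.2 (by linarith)
    refine mul_le_mul_of_nonneg_left (mul_le_mul_of_nonneg_left
      (Finset.sum_le_sum fun i _ => mul_le_mul_of_nonneg_left ?_ hβ.le)
      (by positivity)) ht'
    have := isProbabilityMeasure_uniformBall (x i) hε
    have := (hν0 i).1
    rw [hstart i, one_mul, one_mul]
    exact regret_le_regret_one (η := fun s => ν s i) (ρ := ν0 i)
      (measurable_uncurry_scaledLoss hℓ_meas (y i) κ)
      (fun s => scaledLoss_mem_Icc hℓ hℓ_meas hβ (y i) (κ s))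
      (fun s hs hs1 => by simp only [h0 s hs hs1])
      (fun s hs => eq_tilted_runningMean hℓ hℓ_meas hN hε hβ hκ h1 hs i)
      ((regularizer_ne_top_iff hN).1 hfin i) ht

end DualPotential

end RandomizedAT

end

theorem mainTheorem2
    {E : Type*} [NormedAddCommGroup E] [NormedSpace ℝ E] [FiniteDimensional ℝ E]
    {H : Type*} [TopologicalSpace H] (I : ModelWithCorners ℝ E H)
    {Θ : Type*} [TopologicalSpace Θ] [ChartedSpace H Θ] [IsManifold I ∞ Θ]
    [Bundle.RiemannianBundle (fun θ : Θ => TangentSpace I θ)]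
    [IsContMDiffRiemannianBundle I ∞ E (fun θ : Θ => TangentSpace I θ)]
    [MeasurableSpace Θ] [BorelSpace Θ]
    {𝒴 : Type*} {N d : ℕ} (hN : 0 < N)
    (ℓ : Θ → (Fin d → ℝ) × 𝒴 → ℝ) (U : ℝ)
    (hℓ_nonneg : ∀ θ p, 0 ≤ ℓ θ p) (hℓ_le : ∀ θ p, ℓ θ p ≤ U)
    (hℓ_meas : ∀ b : 𝒴, Measurable (fun p : Θ × (Fin d → ℝ) => ℓ p.1 (p.2, b)))
    (x : Fin N → Fin d → ℝ) (y : Fin N → 𝒴)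
    (ε β γ α : ℝ) (hε : 0 < ε) (hβ : 0 < β) (hγ : 0 ≤ γ) (hα : 0 ≤ α)
    (μ0 : Measure Θ) [IsProbabilityMeasure μ0]
    (ν0 : Fin N → Measure (Fin d → ℝ)) (hν0 : ν0 ∈ RandomizedAT.attackerStrategies x ε)
    (μ : ℝ → Measure Θ) (ν : ℝ → Fin N → Measure (Fin d → ℝ))
    (hflow : RandomizedAT.IsWFRLBRFlow I ℓ x y ε β γ α μ0 ν0 μ ν) :
    -- the terms of the potential are well defined: the running payoff is integrable, the
    -- regularizer is finite along `ν`, and along its time average as soon as it is at `ν0`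
    (∀ t : ℝ, 0 ≤ t → IntervalIntegrable
      (fun s => RandomizedAT.payoff ℓ y (μ s) (ν s)) volume 0 t) ∧
    (∀ t : ℝ, 1 ≤ t → RandomizedAT.regularizer x ε (ν t) ≠ ⊤) ∧
    (RandomizedAT.regularizer x ε ν0 ≠ ⊤ → ∀ t : ℝ, 1 ≤ t →
      RandomizedAT.regularizer x ε (fun i => RandomizedAT.timeAverage (fun s => ν s i) t) ≠ ⊤) ∧
    -- the decay estimate
    (∀ t : ℝ, 1 ≤ t →
      RandomizedAT.dualPotential ℓ x y ε β μ ν t ≤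
        RandomizedAT.dualPotential ℓ x y ε β μ ν 1 / (t : EReal)) := by
  have hℓ : ∀ θ p, ℓ θ p ∈ Icc 0 U := fun θ p => ⟨hℓ_nonneg θ p, hℓ_le θ p⟩
  -- the payoffs and time averages see `μ` only up to null sets of times
  obtain ⟨κ, _, hκ⟩ := RandomizedAT.exists_markovKernel_ae_eq measurableSet_Ici nonempty_Ici
    hflow.meas hflow.prob
  refine ⟨fun t ht => ?_, fun t ht => ?_, fun hfin t ht => ?_, fun t ht => ?_⟩
  · exact RandomizedAT.intervalIntegrable_payoff hℓ hℓ_meas hN hε hβ hν0 hκ hflow.nu_init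
      hflow.nu_lbr ht
  · exact RandomizedAT.regularizer_ne_top_of_bestResponse hℓ hℓ_meas hN hε hβ hκ hflow.nu_lbr ht
  · exact RandomizedAT.regularizer_timeAverage_ne_top hℓ hℓ_meas hN hε hβ hν0 hκ hflow.nu_init
      hflow.nu_lbr hfin ht
  · exact RandomizedAT.dualPotential_le_div hℓ hℓ_meas hN hε hβ hν0 hκ hflow.nu_init
      hflow.nu_lbr ht
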